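/- Let $\mathcal H$ be a separable complex Hilbert space and let $\mathcal S,\mathcal T$ be closed subspaces of $\mathcal H$. A common complement of $\mathcal S$ and $\mathcal T$ is a closed subspace $\mathcal Z$ with $\mathcal S\dotplus\mathcal Z=\mathcal T\dotplus\mathcal Z=\mathcal H$ (direct, not necessarily orthogonal, sums). Dimensions take values in $\{0,1,2,\dots,\infty\}$. Say that closed subspaces $\mathcal U,\mathcal V$ have bi-orthogonal bases if there are sets $I,J\subseteq\mathbb N$ and orthonormal bases $\{\xi_n:n\in I\}$ of $\mathcal U$ and $\{\psi_n:n\in J\}$ of $\mathcal V$ such that $$\langle\xi_n,\psi_k\rangle=0\quad\text{for all } n\in I,\ k\in J,\ n\neq k,\qquad\text{and}\qquad \langle\xi_n,\psi_n\rangle\to0\quad\text{as } n\to\infty,\ n\in I\cap J$$ (the last condition being void if $I\cap J$ is finite). Then $\mathcal S$ and $\mathcal T$ have no common complement if and only if all of the following hold: 1. $\dim(\mathcal S\cap\mathcal T^\perp)\neq\dim(\mathcal S^\perp\cap\mathcal T)$; 2. if $\dim(\mathcal S\cap\mathcal T^\perp)<\infty$, then $\mathcal S$ and $\mathcal T^\perp$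 have bi-orthogonal bases; 3. if $\dim(\mathcal S^\perp\cap\mathcal T)<\infty$, then $\mathcal S^\perp$ and $\mathcal T$ have bi-orthogonal bases. It is also equivalent that 1 holds and that, for at least one of the two dimensions in 1, this dimension is finite and the corresponding pair ($\mathcal S,\mathcal T^\perp$ for the first, $\mathcal S^\perp,\mathcal T$ for the second) has bi-orthogonal bases. -/

import Mathlib

open Filter Topology

noncomputable section

namespace CommonComplement

variable {H : Type*} [NormedAddCommGroup H] [InnerProductSpace ℂ H]

/-- `S` and `T` have a common complement: a closed subspace `Z` with
`S ∔ Z = T ∔ Z = H` (direct, not necessarily orthogonal, sums). -/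
def HasCommonComplement (S T : Submodule ℂ H) : Prop :=
  ∃ Z : Submodule ℂ H, IsClosed (Z : Set H) ∧ IsCompl S Z ∧ IsCompl T Z

/-- The dimension of a subspace of a separable Hilbert space, with values in `{0, 1, 2, …, ∞}`. -/
def dim (V : Submodule ℂ H) : ℕ∞ :=
  Cardinal.toENat (Module.rank ℂ V)

/-- `U` and `V` have orthonormal (Hilbert) bases `{ξ n : n ∈ I}` and `{ψ n : n ∈ J}`, numbered by
sets `I`, `J` of natural numbers, with `⟪ξ n, ψ k⟫ = 0` for `n ≠ k` and `⟪ξ n, ψ n⟫ → 0` as `n → ∞`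
in `I ∩ J` (no condition if `I ∩ J` is finite). The index sets may differ because `U` and `V` may
have different dimensions, and a basis vector of one of them may have no partner in the other. -/
def HasBiorthogonalBases (U V : Submodule ℂ H) : Prop :=
  ∃ (I J : Set ℕ) (ξ : HilbertBasis I ℂ U) (ψ : HilbertBasis J ℂ V),
    (∀ (n : I) (k : J), (n : ℕ) ≠ (k : ℕ) → inner ℂ (ξ n : H) (ψ k : H) = 0) ∧
    Tendsto (fun n : ↥(I ∩ J) => inner ℂ (ξ ⟨n, n.2.1⟩ : H) (ψ ⟨n, n.2.2⟩ : H))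
      (comap (fun n : ↥(I ∩ J) => (n : ℕ)) atTop) (𝓝 0)

end CommonComplement

end

/-!
Let `P`, `Q` be the orthogonal projections onto `S`, `T`, and let `C : S → T` be the restriction of
`Q`, with kernel `S ⊓ Tᗮ` and adjoint kernel `T ⊓ Sᗮ`. The singular value decomposition shows that
`S` and `Tᗮ` have bi-orthogonal bases if and only if the restriction of `1 - Q` to `S` is compact.

If it is compact and `Z` is a common complement, then the projection onto `T` along `Z` restricts to
an isomorphism `S → T` that differs from `C` by a compact operator, so by the Fredholm alternative
the two kernels have the same dimension.

Conversely, for `0 < c < 1` let `L` be the spectral subspace of `|P - Q|` for `(c, ∞)`. It reduces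
both projections and contains both kernels. On `Lᗮ` the projections are at distance less than `1`,
so that there is a common complement there; on `L` the compression has norm less than `1`, so that
there is one as soon as `S ⊓ L` and `T ⊓ L` have the same dimension. By the rank-nullity theorem for
`C` on `L` these dimensions agree whenever the kernels have equal dimensions. If `S ⊓ Tᗮ` is finite
dimensional and there is no common complement, then `S ⊓ L` is finite dimensional for every `c`, so
that `1 - Q` is compact on `S`.
-/

namespace CommonComplement

section CompactOperator

variable {𝕜 E F : Type*} [RCLike 𝕜]
  [NormedAddCommGroup E] [InnerProductSpace 𝕜 E] [NormedAddCommGroup F] [InnerProductSpace 𝕜 F]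

theorem isCompactOperator_comp_starProjection (K : E →L[𝕜] F) (G : Submodule 𝕜 E)
    [FiniteDimensional 𝕜 G] : IsCompactOperator (K ∘L G.starProjection) :=
  have : ProperSpace G := FiniteDimensional.proper 𝕜 G
  (isCompactOperator_of_locallyCompactSpace_rng (K ∘L G.subtypeL)).comp_clm
    G.orthogonalProjectionOnto

theorem isCompactOperator_of_forall_norm_sub_le [CompleteSpace F] {K : E →L[𝕜] F}
    (h : ∀ ε > 0, ∃ C : E →L[𝕜] F, IsCompactOperator C ∧ ‖K - C‖ ≤ ε) : IsCompactOperator K := by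
  refine isClosed_setOfPred_isCompactOperator.closure_subset_iff.2 subset_rfl
    (Metric.mem_closure_iff.2 fun ε hε => ?_)
  obtain ⟨C, hC, hKC⟩ := h (ε / 2) (half_pos hε)
  exact ⟨C, hC, by rw [dist_eq_norm]; linarith⟩

theorem isCompactOperator_of_forall_exists_finiteDimensional [CompleteSpace F] {K : E →L[𝕜] F}
    (h : ∀ ε > 0, ∃ G : Submodule 𝕜 E, FiniteDimensional 𝕜 G ∧ ∀ x ∈ Gᗮ, ‖K x‖ ≤ ε * ‖x‖) :
    IsCompactOperator K := by
  refine isCompactOperator_of_forall_norm_sub_le fun ε hε => ?_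
  obtain ⟨G, _, hG⟩ := h ε hε
  refine ⟨_, isCompactOperator_comp_starProjection K G,
    ContinuousLinearMap.opNorm_le_bound _ hε.le fun x => ?_⟩
  calc ‖(K - K ∘L G.starProjection) x‖ = ‖K (Gᗮ.starProjection x)‖ := by
        simp [Submodule.starProjection_orthogonal_val]
    _ ≤ ε * ‖Gᗮ.starProjection x‖ := hG _ (Submodule.starProjection_apply_mem _ x)
    _ ≤ ε * ‖x‖ := by gcongr; exact Submodule.norm_starProjection_apply_le _ x

theorem exists_finiteDimensional_norm_sub_starProjection_comp_le {K : E →L[𝕜] F}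
    (hK : IsCompactOperator K) {ε : ℝ} (hε : 0 < ε) :
    ∃ (G : Submodule 𝕜 F) (_ : FiniteDimensional 𝕜 G), ‖K - G.starProjection ∘L K‖ ≤ ε := by
  have totallyBounded : TotallyBounded (K '' Metric.closedBall 0 1) :=
    (hK.isCompact_closure_image_closedBall (f := (K : E →ₗ[𝕜] F)) 1).totallyBounded.subset
      subset_closure
  obtain ⟨t, ht, hcover⟩ := Metric.totallyBounded_iff.1 totallyBounded ε hε
  have hfin := FiniteDimensional.span_of_finite 𝕜 ht
  refine ⟨Submodule.span 𝕜 t, hfin,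
    ContinuousLinearMap.opNorm_le_of_unit_norm hε.le fun x hx => ?_⟩
  obtain ⟨g, hg, hgx⟩ := Set.mem_iUnion₂.1 (hcover ⟨x, by simp [hx], rfl⟩)
  calc ‖(K - (Submodule.span 𝕜 t).starProjection ∘L K) x‖
      = ⨅ w : Submodule.span 𝕜 t, ‖K x - w‖ := Submodule.starProjection_minimal (K x)
    _ ≤ ‖K x - g‖ := ciInf_le ⟨0, by rintro _ ⟨w, rfl⟩; positivity⟩
        (⟨g, Submodule.subset_span hg⟩ : Submodule.span 𝕜 t)
    _ ≤ ε := (mem_ball_iff_norm.1 hgx).le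

theorem isCompactOperator_adjoint [CompleteSpace E] [CompleteSpace F] {K : E →L[𝕜] F}
    (hK : IsCompactOperator K) : IsCompactOperator K.adjoint := by
  refine isCompactOperator_of_forall_norm_sub_le fun ε hε => ?_
  obtain ⟨G, _, hG⟩ := exists_finiteDimensional_norm_sub_starProjection_comp_le hK hε
  refine ⟨_, isCompactOperator_comp_starProjection K.adjoint G, ?_⟩
  rwa [← (isSelfAdjoint_starProjection G).adjoint_eq, ← ContinuousLinearMap.adjoint_comp,
    ← map_sub, LinearIsometryEquiv.norm_map]

theorem tendsto_map_orthonormal_of_isCompactOperator [CompleteSpace E] [CompleteSpace F]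
    {K : E →L[𝕜] F} (hK : IsCompactOperator K) {ι : Type*} {e : ι → E} (he : Orthonormal 𝕜 e) :
    Tendsto (fun i => K (e i)) cofinite (𝓝 0) := by
  have weak (y : F) : Tendsto (fun i => inner 𝕜 (K (e i)) y) cofinite (𝓝 0) := by
    rw [tendsto_zero_iff_norm_tendsto_zero]
    simpa [ContinuousLinearMap.adjoint_inner_right] using
      (he.inner_products_summable (K.adjoint y)).tendsto_cofinite_zero.sqrt
  refine (hK.isCompact_closure_image_closedBall (f := (K : E →ₗ[𝕜] F)) 1)
    |>.tendsto_nhds_of_unique_mapClusterPt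
      (.of_forall fun i => subset_closure ⟨e i, by simp [he.1 i], rfl⟩) fun y _ hy => ?_
  obtain ⟨U, hU, hKU⟩ := mapClusterPt_iff_ultrafilter.1 hy
  exact inner_self_eq_zero.1
    (tendsto_nhds_unique (hKU.inner tendsto_const_nhds) ((weak y).mono_left hU))

section Diagonal

variable {ι : Type*} (b : HilbertBasis ι 𝕜 E) {K : E →L[𝕜] F}
  (hK : Pairwise fun i j => inner 𝕜 (K (b i)) (K (b j)) = 0)

include hK

theorem hasSum_norm_sq_map_of_pairwise_orthogonal (x : E) :
    HasSum (fun i => ‖inner 𝕜 (b i) x‖ ^ 2 * ‖K (b i)‖ ^ 2) (‖K x‖ ^ 2) := by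
  have expand (y : F) :
      HasSum (fun i => inner 𝕜 (b i) x * inner 𝕜 y (K (b i))) (inner 𝕜 y (K x)) := by
    simpa [b.repr_apply_apply, inner_smul_right, Function.comp_def] using
      ((innerSL 𝕜 y) ∘L K).hasSum (b.hasSum_repr x)
  have coeff (i : ι) :
      inner 𝕜 (K (b i)) (K x) = inner 𝕜 (b i) x * inner 𝕜 (K (b i)) (K (b i)) :=
    (expand (K (b i))).unique (hasSum_single i fun j hj => by rw [hK hj.symm, mul_zero])
  have term (i : ι) : inner 𝕜 (b i) x * inner 𝕜 (K x) (K (b i)) =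
      ((‖inner 𝕜 (b i) x‖ ^ 2 * ‖K (b i)‖ ^ 2 : ℝ) : 𝕜) := by
    rw [← inner_conj_symm (K x), coeff, map_mul, ← mul_assoc, RCLike.mul_conj, inner_conj_symm,
      inner_self_eq_norm_sq_to_K]
    push_cast
    rfl
  have sum := expand (K x)
  simp only [term, inner_self_eq_norm_sq_to_K] at sum
  exact_mod_cast sum

theorem norm_map_le_of_pairwise_orthogonal {ε : ℝ} (hε : 0 ≤ ε) {x : E}
    (hx : ∀ i, inner 𝕜 (b i) x = 0 ∨ ‖K (b i)‖ ≤ ε) : ‖K x‖ ≤ ε * ‖x‖ := by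
  have parseval : HasSum (fun i => ‖inner 𝕜 (b i) x‖ ^ 2) (‖x‖ ^ 2) := by
    simpa [b.orthonormal.1 _] using
      hasSum_norm_sq_map_of_pairwise_orthogonal b (K := .id 𝕜 E) b.orthonormal.2 x
  refine le_of_sq_le_sq ?_ (by positivity)
  rw [mul_pow]
  refine hasSum_le (fun i => ?_) (hasSum_norm_sq_map_of_pairwise_orthogonal b hK x)
    (parseval.mul_left (ε ^ 2))
  obtain h | h := hx i
  · simp [h]
  · rw [mul_comm]; gcongr

theorem isCompactOperator_of_pairwise_orthogonal [CompleteSpace F]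
    (h0 : Tendsto (fun i => K (b i)) cofinite (𝓝 0)) : IsCompactOperator K := by
  refine isCompactOperator_of_forall_exists_finiteDimensional fun ε hε => ?_
  have hfin : {i | ¬ ‖K (b i)‖ < ε}.Finite := by
    simpa using h0.norm.eventually (gt_mem_nhds (by simpa using hε))
  refine ⟨Submodule.span 𝕜 (b '' {i | ¬ ‖K (b i)‖ < ε}),
    FiniteDimensional.span_of_finite 𝕜 (hfin.image b), fun x hx => ?_⟩
  refine norm_map_le_of_pairwise_orthogonal b hK hε.le fun i => ?_
  by_cases hi : ‖K (b i)‖ < ε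
  · exact .inr hi.le
  · exact .inl (hx _ (Submodule.subset_span ⟨i, hi, rfl⟩))

end Diagonal

theorem exists_hilbertBasis_mem_of_orthogonalFamily [CompleteSpace E] {κ : Type*}
    {V : κ → Submodule 𝕜 E} [∀ k, CompleteSpace (V k)]
    (orthogonal : OrthogonalFamily 𝕜 (fun k => V k) fun k => (V k).subtypeₗᵢ)
    (total : (⨆ k, V k)ᗮ = ⊥) :
    ∃ (s : Set E) (b : HilbertBasis s 𝕜 E), ∀ i, ∃ k, b i ∈ V k := by
  choose w b _ using fun k => exists_hilbertBasis 𝕜 (V k)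
  let v (a : Σ k, w k) : E := b a.1 a.2
  have hv : Orthonormal 𝕜 v := orthogonal.orthonormal_sigma_orthonormal fun k => (b k).orthonormal
  have hspan : (Submodule.span 𝕜 (Set.range v))ᗮ = ⊥ := by
    rw [eq_bot_iff, ← total, ← Submodule.iInf_orthogonal, le_iInf_iff]
    intro k x hx
    rw [← Submodule.orthogonalProjectionOnto_eq_zero_iff, ← (b k).repr.map_eq_zero_iff]
    ext n
    rw [(b k).repr_apply_apply, Submodule.inner_orthogonalProjectionOnto_eq_of_mem_left]
    exact hx _ (Submodule.subset_span ⟨⟨k, n⟩, rfl⟩)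
  refine ⟨Set.range v, .mkOfOrthogonalEqBot hv.toSubtypeRange (by rwa [Subtype.range_coe]), ?_⟩
  rw [HilbertBasis.coe_mkOfOrthogonalEqBot]
  rintro ⟨_, ⟨k, n⟩, rfl⟩
  exact ⟨k, (b k n).2⟩

theorem exists_hilbertBasis_pairwise_orthogonal_map [CompleteSpace E] [CompleteSpace F]
    {K : E →L[𝕜] F} (hK : IsCompactOperator K) :
    ∃ (s : Set E) (b : HilbertBasis s 𝕜 E),
      Pairwise fun i j => inner 𝕜 (K (b i)) (K (b j)) = 0 := by
  have compact : IsCompactOperator (K.adjoint ∘L K) := hK.clm_comp K.adjoint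
  have symmetric : (K.adjoint ∘L K).IsSymmetric :=
    (ContinuousLinearMap.isPositive_adjoint_comp_self K).isSymmetric
  let V (μ : 𝕜) := Module.End.eigenspace (K.adjoint ∘L K : Module.End 𝕜 E) μ
  have (μ : 𝕜) : CompleteSpace (V μ) :=
    (ContinuousLinearMap.isClosed_eigenspace _ μ).completeSpace_coe
  obtain ⟨s, b, hb⟩ := exists_hilbertBasis_mem_of_orthogonalFamily (V := V)
    symmetric.orthogonalFamily_eigenspaces
    (ContinuousLinearMap.orthogonalComplement_iSup_eigenspaces_eq_bot compact symmetric)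
  refine ⟨s, b, fun i j hij => ?_⟩
  obtain ⟨μ, hμ⟩ := hb j
  calc inner 𝕜 (K (b i)) (K (b j)) = inner 𝕜 (b i) ((K.adjoint ∘L K) (b j)) :=
        (K.adjoint_inner_right _ _).symm
    _ = inner 𝕜 (b i) (μ • b j) := by rw [← Module.End.mem_eigenspace_iff.1 hμ]; rfl
    _ = 0 := by rw [inner_smul_right, b.orthonormal.2 hij, mul_zero]

end CompactOperator

section Fredholm

section Banach

variable {𝕜 X Y : Type*} [NontriviallyNormedField 𝕜] [NormedAddCommGroup X] [NormedSpace 𝕜 X]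
  [CompleteSpace X] [NormedAddCommGroup Y] [NormedSpace 𝕜 Y]

theorem surjective_one_sub_of_injective {K : X →L[𝕜] X} (hK : IsCompactOperator K)
    (hinj : Function.Injective (1 - K : X →L[𝕜] X)) :
    Function.Surjective (1 - K : X →L[𝕜] X) := by
  obtain heigen | hresolvent := hK.hasEigenvalue_or_mem_resolventSet one_ne_zero
  · obtain ⟨x, hx⟩ := heigen.exists_hasEigenvector
    exact absurd (hinj (by simpa [sub_eq_zero] using hx.apply_eq_smul.symm)) hx.2
  · rw [spectrum.mem_resolventSet_iff, map_one] at hresolvent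
    exact (ContinuousLinearMap.isUnit_iff_bijective.1 hresolvent).2

theorem surjective_of_injective_of_isCompactOperator_sub {A : X ≃L[𝕜] Y} {C : X →L[𝕜] Y}
    (hAC : IsCompactOperator (A.toContinuousLinearMap - C)) (hC : Function.Injective C) :
    Function.Surjective C := by
  let K := A.symm.toContinuousLinearMap ∘L (A.toContinuousLinearMap - C)
  have factor : ⇑C = A ∘ (1 - K : X →L[𝕜] X) := by ext; simp [K]
  rw [factor] at hC ⊢
  exact A.surjective.comp (surjective_one_sub_of_injective
    (hAC.clm_comp A.symm.toContinuousLinearMap) hC.of_comp)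

end Banach

universe u

variable {𝕜 : Type*} [RCLike 𝕜] {E F : Type u}
  [NormedAddCommGroup E] [InnerProductSpace 𝕜 E] [CompleteSpace E]
  [NormedAddCommGroup F] [InnerProductSpace 𝕜 F]
  {A : E ≃L[𝕜] F} {C : E →L[𝕜] F}

theorem finiteDimensional_ker_of_isCompactOperator_sub
    (hAC : IsCompactOperator (A.toContinuousLinearMap - C)) : FiniteDimensional 𝕜 C.ker := by
  have : CompleteSpace C.ker := C.isClosed_ker.completeSpace_coe
  have hid : C.ker.orthogonalProjectionOnto ∘L A.symm.toContinuousLinearMap ∘L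
      (A.toContinuousLinearMap - C) ∘L C.ker.subtypeL = .id 𝕜 C.ker := by
    ext x
    simp
  refine .of_isCompactOperator_id (𝕜 := 𝕜) ?_
  change IsCompactOperator (ContinuousLinearMap.id 𝕜 C.ker)
  rw [← hid]
  exact (hAC.comp_clm C.ker.subtypeL).clm_comp
    (C.ker.orthogonalProjectionOnto ∘L A.symm.toContinuousLinearMap)

variable [CompleteSpace F]

theorem apply_eq_zero_of_mem_ker_adjoint {x : E} (hx : C x ∈ C.adjoint.ker) : C x = 0 :=
  inner_self_eq_zero.1 <| by
    rw [← C.adjoint_inner_right, show C.adjoint (C x) = 0 from hx, inner_zero_right]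

-- If the inequality fails, adding to `C` an injection `j` of its kernel into that of the adjoint
-- makes it injective, hence surjective; this forces `j` to be onto.
theorem rank_ker_adjoint_le (hAC : IsCompactOperator (A.toContinuousLinearMap - C)) :
    Module.rank 𝕜 C.adjoint.ker ≤ Module.rank 𝕜 C.ker := by
  by_contra! hlt
  have := finiteDimensional_ker_of_isCompactOperator_sub hAC
  have := FiniteDimensional.proper 𝕜 C.ker
  obtain ⟨j, hj⟩ := rank_le_iff_exists_linearMap.1 hlt.le
  let J := C.adjoint.ker.subtypeL ∘L LinearMap.toContinuousLinearMap j
  let P := J ∘L C.ker.orthogonalProjectionOnto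
  have hP (x : E) : P x ∈ C.adjoint.ker := Subtype.property _
  have hcompact : IsCompactOperator (A.toContinuousLinearMap - (C + P)) := by
    rw [← sub_sub]
    exact hAC.sub ((isCompactOperator_of_locallyCompactSpace_rng J).comp_clm _)
  have hinj : Function.Injective (C + P) := by
    rw [injective_iff_map_eq_zero]
    intro x (hx : C x + P x = 0)
    have hCx : C x = 0 := apply_eq_zero_of_mem_ker_adjoint (by
      rw [eq_neg_of_add_eq_zero_left hx]
      exact neg_mem (hP x))
    have hPx : P x = 0 := by rwa [hCx, zero_add] at hx
    have hproj : C.ker.orthogonalProjectionOnto x = ⟨x, hCx⟩ :=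
      Submodule.orthogonalProjectionOnto_mem_subspace_eq_self (K := C.ker) ⟨x, hCx⟩
    have hjx : j ⟨x, hCx⟩ = 0 := Subtype.ext (hproj ▸ hPx)
    exact congr_arg Subtype.val (hj (hjx.trans j.map_zero.symm))
  have hsurj : Function.Surjective j := by
    intro y
    obtain ⟨x, hx : C x + P x = y⟩ :=
      surjective_of_injective_of_isCompactOperator_sub hcompact hinj y
    have hCx : C x = 0 := apply_eq_zero_of_mem_ker_adjoint (by
      rw [eq_sub_of_add_eq hx]
      exact sub_mem y.2 (hP x))
    exact ⟨_, Subtype.ext ((zero_add _).symm.trans (hCx ▸ hx))⟩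
  exact hlt.ne (LinearEquiv.ofBijective j ⟨hj, hsurj⟩).rank_eq

theorem rank_ker_eq_rank_ker_adjoint (hAC : IsCompactOperator (A.toContinuousLinearMap - C)) :
    Module.rank 𝕜 C.ker = Module.rank 𝕜 C.adjoint.ker := by
  refine le_antisymm ?_ (rank_ker_adjoint_le hAC)
  let A' : F ≃L[𝕜] E := .equivOfInverse A.toContinuousLinearMap.adjoint
    A.symm.toContinuousLinearMap.adjoint
    (fun x => ext_inner_left 𝕜 fun y => by simp [ContinuousLinearMap.adjoint_inner_right])
    (fun x => ext_inner_left 𝕜 fun y => by simp [ContinuousLinearMap.adjoint_inner_right])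
  have hAC' : IsCompactOperator (A'.toContinuousLinearMap - C.adjoint) := by
    rw [show A'.toContinuousLinearMap = A.toContinuousLinearMap.adjoint from rfl, ← map_sub]
    exact isCompactOperator_adjoint hAC
  have := rank_ker_adjoint_le hAC'
  rwa [C.adjoint_adjoint] at this

end Fredholm

section Compression

variable {𝕜 H : Type*} [RCLike 𝕜] [NormedAddCommGroup H] [InnerProductSpace 𝕜 H]

/-- The compression of the identity to a pair of subspaces: the orthogonal projection onto `T`,
restricted to `S`. It encodes the relative position of `S` and `T`. -/
noncomputable def compression (S T : Submodule 𝕜 H) [T.HasOrthogonalProjection] : S →L[𝕜] T :=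
  T.orthogonalProjectionOnto ∘L S.subtypeL

variable {S T : Submodule 𝕜 H}

theorem coe_compression_apply [T.HasOrthogonalProjection] (s : S) :
    (compression S T s : H) = T.starProjection s := rfl

theorem inner_compression_left [T.HasOrthogonalProjection] (s : S) (t : T) :
    inner 𝕜 (compression S T s) t = inner 𝕜 (s : H) (t : H) :=
  Submodule.inner_orthogonalProjectionOnto_eq_of_mem_right t s

theorem adjoint_compression [CompleteSpace S] [CompleteSpace T] :
    (compression S T).adjoint = compression T S := by
  symm
  rw [ContinuousLinearMap.eq_adjoint_iff]
  intro t s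
  rw [inner_compression_left, ← inner_conj_symm t, inner_compression_left, inner_conj_symm]

theorem ker_compression [T.HasOrthogonalProjection] :
    (compression S T).ker = (S ⊓ Tᗮ).comap S.subtype := by
  ext s
  simp [compression]

theorem rank_ker_compression [T.HasOrthogonalProjection] :
    Module.rank 𝕜 (compression S T).ker = Module.rank 𝕜 ↥(S ⊓ Tᗮ) := by
  rw [ker_compression]
  exact (Submodule.comapSubtypeEquivOfLe inf_le_left).rank_eq

end Compression

section Rank

variable {𝕜 : Type*} [RCLike 𝕜]

universe u

theorem rank_add_rank_ker_adjoint_le {E F : Type u}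
    [NormedAddCommGroup E] [InnerProductSpace 𝕜 E] [CompleteSpace E]
    [NormedAddCommGroup F] [InnerProductSpace 𝕜 F] [CompleteSpace F] (C : E →L[𝕜] F) :
    Module.rank 𝕜 E + Module.rank 𝕜 C.adjoint.ker ≤ Module.rank 𝕜 F + Module.rank 𝕜 C.ker := by
  have : CompleteSpace C.ker := C.isClosed_ker.completeSpace_coe
  rw [← rank_prod', ← rank_prod']
  let f : E × C.adjoint.ker →ₗ[𝕜] F × C.ker :=
    (LinearMap.coprod C C.adjoint.ker.subtype).prod
      ((C.ker.orthogonalProjectionOnto : E →ₗ[𝕜] C.ker) ∘ₗ LinearMap.fst 𝕜 _ _)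
  refine LinearMap.rank_le_of_injective f ((injective_iff_map_eq_zero f).2 ?_)
  rintro ⟨x, w⟩ hf
  obtain ⟨hxw : C x + w = 0, hx : C.ker.orthogonalProjectionOnto x = 0⟩ := Prod.mk.inj hf
  have hCx : C x = 0 := apply_eq_zero_of_mem_ker_adjoint (by
    rw [eq_neg_of_add_eq_zero_left hxw]
    exact neg_mem w.2)
  have hxmem : x ∈ C.kerᗮ := Submodule.orthogonalProjectionOnto_eq_zero_iff.1 hx
  have hx0 : x = 0 := inner_self_eq_zero.1 (Submodule.inner_right_of_mem_orthogonal hCx hxmem)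
  have hw0 : w = 0 := Subtype.ext (by rwa [hCx, zero_add] at hxw)
  rw [hx0, hw0, Prod.mk_zero_zero]

theorem rank_add_rank_ker_adjoint {E F : Type u}
    [NormedAddCommGroup E] [InnerProductSpace 𝕜 E] [CompleteSpace E]
    [NormedAddCommGroup F] [InnerProductSpace 𝕜 F] [CompleteSpace F] (C : E →L[𝕜] F) :
    Module.rank 𝕜 E + Module.rank 𝕜 C.adjoint.ker = Module.rank 𝕜 F + Module.rank 𝕜 C.ker := by
  have := rank_add_rank_ker_adjoint_le C.adjoint
  rw [C.adjoint_adjoint] at this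
  exact (rank_add_rank_ker_adjoint_le C).antisymm this

end Rank

section Separable

variable {𝕜 E F : Type*} [RCLike 𝕜] [NormedAddCommGroup E] [InnerProductSpace 𝕜 E]
  [NormedAddCommGroup F] [InnerProductSpace 𝕜 F]

theorem countable_of_orthonormal [TopologicalSpace.SeparableSpace E] {ι : Type*} {v : ι → E}
    (hv : Orthonormal 𝕜 v) : Countable ι := by
  refine Pairwise.countable_of_isOpen_disjoint (s := fun i => Metric.ball (v i) (1 / 2))
    (fun i j hij => Metric.ball_disjoint_ball ?_) (fun _ => Metric.isOpen_ball)
    fun i => ⟨v i, Metric.mem_ball_self (by norm_num)⟩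
  have dist_sq : dist (v i) (v j) ^ 2 = 2 := by
    rw [dist_eq_norm, @norm_sub_sq 𝕜, hv.1, hv.1, hv.2 hij]
    norm_num
  nlinarith [dist_nonneg (x := v i) (y := v j)]

theorem exists_hilbertBasis_reindex [CompleteSpace E] {ι κ : Type*} (b : HilbertBasis ι 𝕜 E)
    (e : κ ≃ ι) : ∃ b' : HilbertBasis κ 𝕜 E, ⇑b' = b ∘ e :=
  ⟨.mk (b.orthonormal.comp e e.injective) (by rw [e.surjective.range_comp, b.dense_span]),
    HilbertBasis.coe_mk _ _⟩

theorem nonempty_hilbertBasis_nat [CompleteSpace E] [TopologicalSpace.SeparableSpace E]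
    (h : ¬ FiniteDimensional 𝕜 E) : Nonempty (HilbertBasis ℕ 𝕜 E) := by
  obtain ⟨w, b, -⟩ := exists_hilbertBasis 𝕜 E
  have : Countable w := countable_of_orthonormal b.orthonormal
  have : Infinite w := by
    by_contra hfin
    rw [not_infinite_iff_finite] at hfin
    have := Fintype.ofFinite w
    exact h b.toOrthonormalBasis.toBasis.finiteDimensional_of_finite
  obtain ⟨e⟩ := nonempty_equiv_of_countable (α := ℕ) (β := w)
  exact ⟨(exists_hilbertBasis_reindex b e).choose⟩

theorem nonempty_linearIsometryEquiv_of_toENat_rank_eq [CompleteSpace E] [CompleteSpace F]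
    [TopologicalSpace.SeparableSpace E] [TopologicalSpace.SeparableSpace F]
    (h : Cardinal.toENat (Module.rank 𝕜 E) = Cardinal.toENat (Module.rank 𝕜 F)) :
    Nonempty (E ≃ₗᵢ[𝕜] F) := by
  have finite_iff : FiniteDimensional 𝕜 E ↔ FiniteDimensional 𝕜 F := by
    simp only [FiniteDimensional, ← Module.rank_lt_aleph0_iff, ← Cardinal.toENat_lt_top, h]
  by_cases hE : FiniteDimensional 𝕜 E
  · have := finite_iff.1 hE
    have finrank_eq : Module.finrank 𝕜 E = Module.finrank 𝕜 F := congr_arg ENat.toNat h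
    exact ⟨(stdOrthonormalBasis 𝕜 E).equiv (stdOrthonormalBasis 𝕜 F) (finCongr finrank_eq)⟩
  · obtain ⟨b⟩ := nonempty_hilbertBasis_nat hE
    obtain ⟨b'⟩ := nonempty_hilbertBasis_nat fun hF => hE (finite_iff.2 hF)
    exact ⟨b.repr.trans b'.repr.symm⟩

end Separable

section Dim

variable {H : Type*} [NormedAddCommGroup H] [InnerProductSpace ℂ H] {S T : Submodule ℂ H}

theorem dim_mono (h : S ≤ T) : dim S ≤ dim T :=
  Cardinal.toENat.monotone' (Submodule.rank_mono h)

theorem dim_lt_top_iff : dim S < ⊤ ↔ FiniteDimensional ℂ S := by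
  rw [dim, Cardinal.toENat_lt_top]
  exact Module.rank_lt_aleph0_iff

theorem dim_add_dim_inf_orthogonal [CompleteSpace S] [CompleteSpace T] :
    dim S + dim (T ⊓ Sᗮ) = dim T + dim (S ⊓ Tᗮ) := by
  have := rank_add_rank_ker_adjoint (compression S T)
  rw [adjoint_compression, rank_ker_compression, rank_ker_compression] at this
  simp only [dim, ← map_add, this]

end Dim

theorem exists_injective_nat_of_biUnique {ι κ : Type*} [Countable ι] [Countable κ]
    {r : ι → κ → Prop} (hr : Relator.BiUnique r) :
    ∃ (p : ι → ℕ) (q : κ → ℕ), Function.Injective p ∧ Function.Injective q ∧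
      ∀ i k, r i k → p i = q k := by
  classical
  obtain ⟨f, hf⟩ := exists_injective_nat (ι ⊕ κ)
  let partner (i : ι) : ι ⊕ κ := if h : ∃ k, r i k then .inr h.choose else .inl i
  have partner_of_rel {i k} (h : r i k) : partner i = .inr k := by
    have hex : ∃ k, r i k := ⟨k, h⟩
    simp only [partner, dif_pos hex, hr.2 hex.choose_spec h]
  have partner_of_not {i} (h : ¬ ∃ k, r i k) : partner i = .inl i := dif_neg h
  refine ⟨f ∘ partner, f ∘ Sum.inr, hf.comp fun i j hij => ?_, hf.comp Sum.inr_injective,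
    fun i k h => congr_arg f (partner_of_rel h)⟩
  by_cases hi : ∃ k, r i k <;> by_cases hj : ∃ k, r j k
  · obtain ⟨⟨k, hk⟩, l, hl⟩ := hi, hj
    rw [partner_of_rel hk, partner_of_rel hl, Sum.inr.injEq] at hij
    exact hr.1 hk (hij ▸ hl)
  · obtain ⟨k, hk⟩ := hi
    simp [partner_of_rel hk, partner_of_not hj] at hij
  · obtain ⟨l, hl⟩ := hj
    simp [partner_of_rel hl, partner_of_not hi] at hij
  · simpa [partner_of_not hi, partner_of_not hj] using hij

section Diagonalization

variable {𝕜 E F : Type*} [RCLike 𝕜] [NormedAddCommGroup E] [InnerProductSpace 𝕜 E]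
  [NormedAddCommGroup F] [InnerProductSpace 𝕜 F]

theorem biUnique_inner_ne_zero {ι κ : Type*} {v : ι → F}
    (hv : Pairwise fun i j => inner 𝕜 (v i) (v j) = 0) {b : κ → F} (hb : Orthonormal 𝕜 b)
    (hvb : ∀ i, v i ≠ 0 → ∃ k, v i = (‖v i‖ : 𝕜) • b k) :
    Relator.BiUnique fun i k => inner 𝕜 (v i) (b k) ≠ 0 := by
  have eq_smul {i k} (h : inner 𝕜 (v i) (b k) ≠ 0) : v i = (‖v i‖ : 𝕜) • b k := by
    obtain ⟨l, hl⟩ := hvb i fun h0 => h (by rw [h0, inner_zero_left])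
    obtain rfl | hlk := eq_or_ne l k
    · exact hl
    · exact absurd (by rw [hl, inner_smul_left, hb.2 hlk, mul_zero]) h
  constructor
  · intro i j k hi hj
    by_contra hij
    have hvij : inner 𝕜 (v i) (v j) = 0 := hv hij
    rw [eq_smul hj, inner_smul_right] at hvij
    have hvj : v j = 0 := by simpa [hi] using hvij
    exact hj (by rw [hvj, inner_zero_left])
  · intro i k l hk hl
    by_contra hkl
    exact hl (by rw [eq_smul hk, inner_smul_left, hb.2 hkl, mul_zero])

variable [CompleteSpace F] {K : E →L[𝕜] F}

theorem isCompactOperator_of_diagonal {κ : Type*} {I J : Set κ}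
    (ξ : HilbertBasis I 𝕜 E) (ψ : HilbertBasis J 𝕜 F)
    (off_diagonal : ∀ (n : I) (k : J), (n : κ) ≠ k → inner 𝕜 (K (ξ n)) (ψ k) = 0)
    (diagonal : Tendsto (fun n : ↥(I ∩ J) => inner 𝕜 (K (ξ ⟨n, n.2.1⟩)) (ψ ⟨n, n.2.2⟩))
      cofinite (𝓝 0)) :
    IsCompactOperator K := by
  have off_diagonal' (n : I) (k : J) (hnk : (n : κ) ≠ k) : inner 𝕜 (ψ k) (K (ξ n)) = 0 :=
    inner_eq_zero_symm.1 (off_diagonal n k hnk)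
  refine isCompactOperator_of_pairwise_orthogonal ξ (fun i j hij => ?_) ?_
  · refine (ψ.hasSum_inner_mul_inner (K (ξ i)) (K (ξ j))).unique ?_
    convert hasSum_zero with k
    by_cases hik : (i : κ) = k
    · rw [off_diagonal' j k fun hjk => hij (Subtype.ext (hik.trans hjk.symm)), mul_zero]
    · rw [off_diagonal i k hik, zero_mul]
  · have map_eq (n : I) (hn : (n : κ) ∈ J) :
        K (ξ n) = inner 𝕜 (ψ ⟨n, hn⟩) (K (ξ n)) • ψ ⟨n, hn⟩ := by
      refine (ψ.hasSum_repr (K (ξ n))).unique ?_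
      simp only [ψ.repr_apply_apply]
      exact hasSum_single _ fun k hk => by
        rw [off_diagonal' n k fun hnk => hk (Subtype.ext hnk.symm), zero_smul]
    have map_eq_zero (n : I) (hn : (n : κ) ∉ J) : K (ξ n) = 0 := by
      refine (ψ.hasSum_repr (K (ξ n))).unique ?_
      simp only [ψ.repr_apply_apply]
      convert hasSum_zero with k
      rw [off_diagonal' n k fun hnk => hn (hnk ▸ k.2), zero_smul]
    rw [tendsto_zero_iff_norm_tendsto_zero] at diagonal ⊢
    intro s hs
    refine ((diagonal hs : Set.Finite _).image (Set.inclusion Set.inter_subset_left)).subset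
      fun n hn => ?_
    by_cases hnJ : (n : κ) ∈ J
    · refine ⟨⟨n, n.2, hnJ⟩, fun hmem => hn ?_, rfl⟩
      rw [Set.mem_preimage, map_eq n hnJ, norm_smul, ψ.orthonormal.1, mul_one, norm_inner_symm]
      exact hmem
    · exact (hn (by simpa [map_eq_zero n hnJ] using mem_of_mem_nhds hs)).elim

theorem exists_hilbertBasis_eq_smul {ι : Type*} {v : ι → F}
    (hv : Pairwise fun i j => inner 𝕜 (v i) (v j) = 0) :
    ∃ (s : Set F) (b : HilbertBasis s 𝕜 F), ∀ i, v i ≠ 0 → ∃ k, v i = (‖v i‖ : 𝕜) • b k := by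
  let u (i : {i // v i ≠ 0}) : F := (‖v i‖⁻¹ : 𝕜) • v i
  have hu : Orthonormal 𝕜 u :=
    ⟨fun i => norm_smul_inv_norm i.2, fun i j hij => by
      simp [u, inner_smul_left, inner_smul_right, hv (Subtype.coe_ne_coe.2 hij)]⟩
  obtain ⟨s, b, hs, hb⟩ := hu.toSubtypeRange.exists_hilbertBasis_extension
  refine ⟨s, b, fun i hi => ⟨⟨u ⟨i, hi⟩, hs ⟨_, rfl⟩⟩, ?_⟩⟩
  rw [hb]
  exact (smul_inv_smul₀ (by simpa using hi) (v i)).symm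

theorem exists_diagonal_of_isCompactOperator [CompleteSpace E]
    [TopologicalSpace.SeparableSpace E] [TopologicalSpace.SeparableSpace F]
    (hK : IsCompactOperator K) :
    ∃ (I J : Set ℕ) (ξ : HilbertBasis I 𝕜 E) (ψ : HilbertBasis J 𝕜 F),
      ∀ (n : I) (k : J), (n : ℕ) ≠ k → inner 𝕜 (K (ξ n)) (ψ k) = 0 := by
  obtain ⟨s, e, he⟩ := exists_hilbertBasis_pairwise_orthogonal_map hK
  obtain ⟨t, b, hb⟩ := exists_hilbertBasis_eq_smul he
  have := countable_of_orthonormal e.orthonormal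
  have := countable_of_orthonormal b.orthonormal
  obtain ⟨p, q, hp, hq, hpq⟩ :=
    exists_injective_nat_of_biUnique (biUnique_inner_ne_zero he b.orthonormal hb)
  obtain ⟨ξ, hξ⟩ := exists_hilbertBasis_reindex e (Equiv.ofInjective p hp).symm
  obtain ⟨ψ, hψ⟩ := exists_hilbertBasis_reindex b (Equiv.ofInjective q hq).symm
  refine ⟨_, _, ξ, ψ, fun n k hnk => ?_⟩
  by_contra hne
  rw [hξ, hψ] at hne
  exact hnk (by simpa [Equiv.apply_ofInjective_symm] using hpq _ _ hne)

end Diagonalization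

section Biorthogonal

variable {H : Type*} [NormedAddCommGroup H] [InnerProductSpace ℂ H] {U V : Submodule ℂ H}

theorem HasBiorthogonalBases.symm (h : HasBiorthogonalBases U V) : HasBiorthogonalBases V U := by
  obtain ⟨I, J, ξ, ψ, off_diagonal, diagonal⟩ := h
  refine ⟨J, I, ψ, ξ, fun n k hnk => inner_eq_zero_symm.1 (off_diagonal k n hnk.symm), ?_⟩
  have swap : Tendsto (fun n : ↥(J ∩ I) => (⟨n, n.2.2, n.2.1⟩ : ↥(I ∩ J)))
      (comap (fun n : ↥(J ∩ I) => (n : ℕ)) atTop) (comap (fun n : ↥(I ∩ J) => (n : ℕ)) atTop) :=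
    tendsto_comap_iff.2 tendsto_comap
  have := (Complex.continuous_conj.tendsto 0).comp (diagonal.comp swap)
  rw [map_zero] at this
  exact this.congr fun n => inner_conj_symm _ _

theorem hasBiorthogonalBases_comm : HasBiorthogonalBases U V ↔ HasBiorthogonalBases V U :=
  ⟨.symm, .symm⟩

theorem hasBiorthogonalBases_iff_isCompactOperator_compression
    [TopologicalSpace.SeparableSpace H] [CompleteSpace U] [CompleteSpace V] :
    HasBiorthogonalBases U V ↔ IsCompactOperator (compression U V) := by
  have comap_eq (A : Set ℕ) : comap (fun n : A => (n : ℕ)) atTop = cofinite := by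
    rw [← Nat.cofinite_eq_atTop, Subtype.val_injective.comap_cofinite_eq]
  simp only [HasBiorthogonalBases, ← inner_compression_left, comap_eq]
  constructor
  · rintro ⟨I, J, ξ, ψ, off_diagonal, diagonal⟩
    exact isCompactOperator_of_diagonal ξ ψ off_diagonal diagonal
  · intro hK
    obtain ⟨I, J, ξ, ψ, off_diagonal⟩ := exists_diagonal_of_isCompactOperator hK
    refine ⟨I, J, ξ, ψ, off_diagonal, ?_⟩
    have norm_map_tendsto :=
      (tendsto_map_orthonormal_of_isCompactOperator hK ξ.orthonormal).norm.comp
        (Set.inclusion_injective (Set.inter_subset_left (s := I) (t := J))).tendsto_cofinite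
    rw [norm_zero] at norm_map_tendsto
    refine squeeze_zero_norm (fun n => ?_) norm_map_tendsto
    refine (norm_inner_le_norm _ _).trans_eq ?_
    rw [ψ.orthonormal.1, mul_one]
    rfl

end Biorthogonal

section Obstruction

variable {H : Type*} [NormedAddCommGroup H] [InnerProductSpace ℂ H] {S T : Submodule ℂ H}

theorem HasCommonComplement.symm (h : HasCommonComplement S T) : HasCommonComplement T S := by
  obtain ⟨Z, hZ, hS, hT⟩ := h
  exact ⟨Z, hZ, hT, hS⟩

theorem hasCommonComplement_comm : HasCommonComplement S T ↔ HasCommonComplement T S :=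
  ⟨.symm, .symm⟩

variable [CompleteSpace H] [CompleteSpace T]

theorem HasCommonComplement.exists_bijective_comp_subtypeL (h : HasCommonComplement S T) :
    ∃ π : H →L[ℂ] T, (∀ t : T, π t = t) ∧ Function.Bijective (π ∘L S.subtypeL) := by
  obtain ⟨Z, hZ, hS, hT⟩ := h
  have isClosed_T : IsClosed (T : Set H) :=
    (completeSpace_coe_iff_isComplete.1 ‹CompleteSpace T›).isClosed
  have hTZ := Submodule.IsCompl.isTopCompl_of_isClosed hT isClosed_T hZ
  refine ⟨T.projectionOntoL Z hTZ, Submodule.projectionOntoL_apply_left hTZ,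
    (injective_iff_map_eq_zero _).2 fun s hs => ?_, fun t => ?_⟩
  · have hsZ : (s : H) ∈ Z := (Submodule.projectionOntoL_apply_eq_zero_iff hTZ).1 hs
    exact Subtype.ext (Submodule.disjoint_def.1 hS.disjoint s s.2 hsZ)
  · obtain ⟨s, z, hs, hz, hsz⟩ :=
      Submodule.codisjoint_iff_exists_add_eq.1 hS.codisjoint (t : H)
    refine ⟨⟨s, hs⟩, ?_⟩
    rw [ContinuousLinearMap.comp_apply, Submodule.subtypeL_apply, ← sub_eq_zero,
      ← Submodule.projectionOntoL_apply_left hTZ t, ← map_sub,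
      Submodule.projectionOntoL_apply_eq_zero_iff hTZ, ← hsz, sub_add_cancel_left]
    exact neg_mem hz

theorem HasCommonComplement.dim_inf_orthogonal_eq [CompleteSpace S]
    (h : HasCommonComplement S T) (hK : IsCompactOperator (compression S Tᗮ)) :
    dim (S ⊓ Tᗮ) = dim (T ⊓ Sᗮ) := by
  obtain ⟨π, hπ, hbij⟩ := h.exists_bijective_comp_subtypeL
  let A : S ≃L[ℂ] T := .ofBijective (π ∘L S.subtypeL) (LinearMap.ker_eq_bot.2 hbij.1)
    (LinearMap.range_eq_top.2 hbij.2)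
  have sub_eq : A.toContinuousLinearMap - compression S T
      = (π ∘L Tᗮ.subtypeL) ∘L compression S Tᗮ := by
    ext1 s
    change π s - compression S T s = π (Tᗮ.starProjection s)
    rw [Submodule.starProjection_orthogonal_val, map_sub, ← coe_compression_apply, hπ]
  have compact_sub : IsCompactOperator (A.toContinuousLinearMap - compression S T) := by
    rw [sub_eq]
    exact hK.clm_comp (π ∘L Tᗮ.subtypeL)
  have := rank_ker_eq_rank_ker_adjoint compact_sub
  rw [adjoint_compression, rank_ker_compression, rank_ker_compression] at this
  rw [dim, dim, this]

end Obstruction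

section Norm

variable {𝕜 E F : Type*} [RCLike 𝕜] [NormedAddCommGroup E] [NormedSpace 𝕜 E] [CompleteSpace E]
  [NormedAddCommGroup F] [NormedSpace 𝕜 F]

theorem bijective_linearIsometryEquiv_add (U : E ≃ₗᵢ[𝕜] F) {K : E →L[𝕜] F} (hK : ‖K‖ < 1) :
    Function.Bijective (U.toLinearIsometry.toContinuousLinearMap + K) := by
  let L : E →L[𝕜] E := U.symm.toLinearIsometry.toContinuousLinearMap ∘L K
  have hL : ‖-L‖ < 1 := by rwa [norm_neg, LinearIsometry.norm_toContinuousLinearMap_comp]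
  have factor : ⇑(U.toLinearIsometry.toContinuousLinearMap + K) = U ∘ (1 - -L : E →L[𝕜] E) := by
    ext x
    simp [L]
  rw [factor]
  exact U.bijective.comp (ContinuousLinearMap.isUnit_iff_bijective.1
    (isUnit_one_sub_of_norm_lt_one hL))

end Norm

section CompressionNorm

variable {𝕜 H : Type*} [RCLike 𝕜] [NormedAddCommGroup H] [InnerProductSpace 𝕜 H]
  {S T : Submodule 𝕜 H}

theorem norm_compression_le_one [T.HasOrthogonalProjection] : ‖compression S T‖ ≤ 1 :=
  ContinuousLinearMap.opNorm_le_bound _ zero_le_one fun s => by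
    rw [one_mul]
    exact T.norm_orthogonalProjectionOnto_apply_le s

theorem norm_compression_comm [CompleteSpace S] [CompleteSpace T] :
    ‖compression T S‖ = ‖compression S T‖ := by
  rw [← adjoint_compression, LinearIsometryEquiv.norm_map]

end CompressionNorm

section Criteria

variable {H : Type*} [NormedAddCommGroup H] [InnerProductSpace ℂ H] {S T : Submodule ℂ H}

theorem isCompl_ker_of_bijective_comp_subtypeL {E : Type*} [NormedAddCommGroup E]
    [NormedSpace ℂ E] {W : H →L[ℂ] E} (hS : Function.Bijective (W ∘L S.subtypeL)) :
    IsCompl S W.ker := by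
  refine ⟨Submodule.disjoint_def.2 fun x hx hWx => ?_, codisjoint_iff.2 (eq_top_iff.2 ?_)⟩
  · exact congr_arg Subtype.val (hS.1 (a₁ := ⟨x, hx⟩) (a₂ := 0) (hWx.trans (map_zero W).symm))
  · intro x _
    obtain ⟨s, hs : W s = W x⟩ := hS.2 (W x)
    exact Submodule.mem_sup.2 ⟨s, s.2, x - s, by simp [hs], by abel⟩

theorem hasCommonComplement_of_bijective_comp_subtypeL {E : Type*} [NormedAddCommGroup E]
    [NormedSpace ℂ E] {W : H →L[ℂ] E} (hS : Function.Bijective (W ∘L S.subtypeL))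
    (hT : Function.Bijective (W ∘L T.subtypeL)) : HasCommonComplement S T :=
  ⟨W.ker, W.isClosed_ker, isCompl_ker_of_bijective_comp_subtypeL hS,
    isCompl_ker_of_bijective_comp_subtypeL hT⟩

variable [CompleteSpace S] [CompleteSpace T]

theorem hasCommonComplement_of_norm_compression_lt_one (U : S ≃ₗᵢ[ℂ] T)
    (h : ‖compression S T‖ < 1) : HasCommonComplement S T := by
  -- Restricted to `S` and to `T`, the operator `W` is a strict contraction away from an isometry.
  let W : H →L[ℂ] T := U.toLinearIsometry.toContinuousLinearMap ∘L S.orthogonalProjectionOnto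
    + T.orthogonalProjectionOnto
  refine hasCommonComplement_of_bijective_comp_subtypeL (W := W) ?_ ?_
  · convert bijective_linearIsometryEquiv_add U h
    ext s
    simp [W, compression]
  · have hU : ‖U.toLinearIsometry.toContinuousLinearMap ∘L compression T S‖ < 1 := by
      rwa [LinearIsometry.norm_toContinuousLinearMap_comp, norm_compression_comm]
    convert bijective_linearIsometryEquiv_add (.refl ℂ T) hU
    ext t
    simp [W, compression, add_comm]

theorem compression_comp_compression :
    compression T S ∘L compression S T = 1 - compression Tᗮ S ∘L compression S Tᗮ := by
  ext s
  simp [compression]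

theorem bijective_compression_comp_compression (h : ‖compression S Tᗮ‖ < 1) :
    Function.Bijective (compression T S ∘L compression S T) := by
  rw [compression_comp_compression]
  refine ContinuousLinearMap.isUnit_iff_bijective.1 (isUnit_one_sub_of_norm_lt_one ?_)
  calc ‖compression Tᗮ S ∘L compression S Tᗮ‖ ≤ ‖compression Tᗮ S‖ * ‖compression S Tᗮ‖ :=
        ContinuousLinearMap.opNorm_comp_le _ _
    _ ≤ 1 * ‖compression S Tᗮ‖ := by gcongr; exact norm_compression_le_one
    _ < 1 := by rwa [one_mul]

theorem hasCommonComplement_of_norm_compression_orthogonal_lt_one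
    (hST : ‖compression S Tᗮ‖ < 1) (hTS : ‖compression T Sᗮ‖ < 1) : HasCommonComplement S T := by
  have injective : Function.Injective (compression S T) :=
    .of_comp (f := compression T S) (bijective_compression_comp_compression hST).1
  have surjective : Function.Surjective (compression S T) :=
    .of_comp (g := compression T S) (bijective_compression_comp_compression hTS).2
  refine hasCommonComplement_of_bijective_comp_subtypeL (W := T.orthogonalProjectionOnto)
    ⟨injective, surjective⟩ ?_
  convert Function.bijective_id
  ext t
  simp

end Criteria

section Reducing

variable {𝕜 H : Type*} [RCLike 𝕜] [NormedAddCommGroup H] [InnerProductSpace 𝕜 H]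
  {L S : Submodule 𝕜 H}

instance completeSpace_inf [CompleteSpace H] [CompleteSpace L] [CompleteSpace S] :
    CompleteSpace ↥(L ⊓ S) :=
  ((completeSpace_coe_iff_isComplete.1 ‹CompleteSpace L›).isClosed.inter
    (completeSpace_coe_iff_isComplete.1 ‹CompleteSpace S›).isClosed).completeSpace_coe

section Commute

variable [L.HasOrthogonalProjection]

theorem commute_starProjection_orthogonal {f : H →L[𝕜] H} (h : Commute L.starProjection f) :
    Commute Lᗮ.starProjection f := by
  rw [Submodule.starProjection_orthogonal']
  exact (Commute.one_left _).sub_left h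

variable [S.HasOrthogonalProjection]

theorem starProjection_mem_of_commute (h : Commute L.starProjection S.starProjection) {x : H}
    (hx : x ∈ S) : L.starProjection x ∈ S := by
  have := DFunLike.congr_fun h.eq x
  rw [← Submodule.starProjection_eq_self_iff] at hx ⊢
  rw [mul_apply_eq_comp, mul_apply_eq_comp, hx] at this
  exact this.symm

theorem starProjection_inf_apply [(S ⊓ L).HasOrthogonalProjection]
    (h : Commute L.starProjection S.starProjection) {x : H} (hx : x ∈ L) :
    (S ⊓ L).starProjection x = S.starProjection x :=
  Submodule.eq_starProjection_of_mem_orthogonal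
    ⟨S.starProjection_apply_mem x, starProjection_mem_of_commute h.symm hx⟩
    (Submodule.orthogonal_le inf_le_left (S.sub_starProjection_mem_orthogonal x))

theorem mem_orthogonal_of_mem_inf_orthogonal (h : Commute L.starProjection S.starProjection)
    {x : H} (hxS : x ∈ S) (hx : x ∈ (S ⊓ L)ᗮ) : x ∈ Lᗮ := by
  have hxL : L.starProjection x ∈ S ⊓ L :=
    ⟨starProjection_mem_of_commute h hxS, L.starProjection_apply_mem x⟩
  rw [← Submodule.starProjection_apply_eq_zero_iff, ← inner_self_eq_zero (𝕜 := 𝕜),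
    Submodule.inner_starProjection_left_eq_right, Submodule.starProjection_eq_self_iff.2 hxL.2,
    ← inner_conj_symm, hx _ hxL, map_zero]

theorem isCompl_comap_inf_comap (h : Commute L.starProjection S.starProjection)
    {Z Z' : Submodule 𝕜 H} (hZ : IsCompl (S ⊓ L) Z) (hZ' : IsCompl (S ⊓ Lᗮ) Z') :
    IsCompl S (Z.comap L.starProjection.toLinearMap ⊓ Z'.comap Lᗮ.starProjection.toLinearMap) := by
  have h' := commute_starProjection_orthogonal h
  have decomp (x : H) : L.starProjection x + Lᗮ.starProjection x = x :=
    L.starProjection_add_starProjection_orthogonal x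
  refine ⟨Submodule.disjoint_def.2 fun x hx hxZ => ?_,
    Submodule.codisjoint_iff_exists_add_eq.2 fun x => ?_⟩
  · rw [← decomp x,
      Submodule.disjoint_def.1 hZ.disjoint _
        ⟨starProjection_mem_of_commute h hx, L.starProjection_apply_mem x⟩ hxZ.1,
      Submodule.disjoint_def.1 hZ'.disjoint _
        ⟨starProjection_mem_of_commute h' hx, Lᗮ.starProjection_apply_mem x⟩ hxZ.2, add_zero]
  · obtain ⟨s, z, hs, hz, hsz⟩ :=
      Submodule.codisjoint_iff_exists_add_eq.1 hZ.codisjoint (L.starProjection x)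
    obtain ⟨s', z', hs', hz', hsz'⟩ :=
      Submodule.codisjoint_iff_exists_add_eq.1 hZ'.codisjoint (Lᗮ.starProjection x)
    have hzL : z ∈ L := by
      rw [eq_sub_of_add_eq' hsz]
      exact sub_mem (L.starProjection_apply_mem x) hs.2
    have hzL' : z' ∈ Lᗮ := by
      rw [eq_sub_of_add_eq' hsz']
      exact sub_mem (Lᗮ.starProjection_apply_mem x) hs'.2
    refine ⟨s + s', z + z', add_mem hs.1 hs'.1, ⟨?_, ?_⟩, ?_⟩
    · change L.starProjection (z + z') ∈ Z
      rwa [Submodule.eq_starProjection_of_mem_orthogonal' hzL hzL' rfl]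
    · change Lᗮ.starProjection (z + z') ∈ Z'
      rwa [Submodule.eq_starProjection_of_mem_orthogonal' hzL'
        (Submodule.le_orthogonal_orthogonal L hzL) (add_comm z z')]
    · rw [add_add_add_comm, hsz, hsz', decomp]

end Commute

end Reducing

section Glue

variable {H : Type*} [NormedAddCommGroup H] [InnerProductSpace ℂ H] {L S T : Submodule ℂ H}

theorem hasCommonComplement_of_commute [L.HasOrthogonalProjection] [S.HasOrthogonalProjection]
    [T.HasOrthogonalProjection] (hS : Commute L.starProjection S.starProjection)
    (hT : Commute L.starProjection T.starProjection)
    (h : HasCommonComplement (S ⊓ L) (T ⊓ L)) (h' : HasCommonComplement (S ⊓ Lᗮ) (T ⊓ Lᗮ)) :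
    HasCommonComplement S T := by
  obtain ⟨Z, hZ, hSZ, hTZ⟩ := h
  obtain ⟨Z', hZ', hSZ', hTZ'⟩ := h'
  exact ⟨_, (hZ.preimage L.starProjection.continuous).inter
    (hZ'.preimage Lᗮ.starProjection.continuous), isCompl_comap_inf_comap hS hSZ hSZ',
    isCompl_comap_inf_comap hT hTZ hTZ'⟩

end Glue

section PositivePart

variable {H : Type*} [NormedAddCommGroup H] [InnerProductSpace ℂ H] [CompleteSpace H]
  {a d f : H →L[ℂ] H}

/-- The orthogonal complement of the kernel of the positive part of `a`: for self-adjoint `a`, the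
spectral subspace of `a` for `(0, ∞)`. -/
noncomputable def positiveSubspace (a : H →L[ℂ] H) : Submodule ℂ H := (a⁺).kerᗮ

instance : CompleteSpace (positiveSubspace a) :=
  inferInstanceAs (CompleteSpace ↥((a⁺).kerᗮ))

theorem commute_starProjection_positiveSubspace (hf : IsSelfAdjoint f) (h : Commute a f) :
    Commute (positiveSubspace a).starProjection f := by
  have ker_invariant : (a⁺).ker ∈ Module.End.invtSubmodule f.adjoint.toLinearMap := by
    have : Commute a⁺ f := by
      rw [CFC.posPart_def]
      exact h.cfcₙ_real _
    rw [hf.adjoint_eq, Module.End.mem_invtSubmodule_iff_forall_mem_of_mem]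
    intro x (hx : a⁺ x = 0)
    have hfx : a⁺ (f x) = f (a⁺ x) := DFunLike.congr_fun this.eq x
    exact hfx.trans (by rw [hx, map_zero])
  have orthogonal_invariant := ContinuousLinearMap.orthogonal_mem_invtSubmodule ker_invariant
  have : CompleteSpace (a⁺).ker := (a⁺).isClosed_ker.completeSpace_coe
  rw [hf.adjoint_eq] at ker_invariant
  rw [ContinuousLinearMap.IsIdempotentElem.commute_iff
      (Submodule.isIdempotentElem_starProjection _),
    Submodule.range_starProjection, Submodule.ker_starProjection, positiveSubspace,
    Submodule.orthogonal_orthogonal]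
  exact ⟨orthogonal_invariant, ker_invariant⟩

theorem re_inner_apply_self_nonneg_of_mem_positiveSubspace (ha : IsSelfAdjoint a) {x : H}
    (hx : x ∈ positiveSubspace a) : 0 ≤ RCLike.re (inner ℂ (a x) x) := by
  have negPart_mem : a⁻ x ∈ (a⁺).ker := DFunLike.congr_fun (CFC.posPart_mul_negPart a) x
  have posPart_nonneg : (a⁺).IsPositive :=
    (ContinuousLinearMap.nonneg_iff_isPositive _).1 (CFC.posPart_nonneg a)
  rw [← CFC.posPart_sub_negPart a ha, sub_apply, inner_sub_left, hx _ negPart_mem, sub_zero]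
  exact posPart_nonneg.2 x

theorem re_inner_apply_self_nonpos_of_mem_orthogonal_positiveSubspace (ha : IsSelfAdjoint a)
    {x : H} (hx : x ∈ (positiveSubspace a)ᗮ) : RCLike.re (inner ℂ (a x) x) ≤ 0 := by
  have : CompleteSpace (a⁺).ker := (a⁺).isClosed_ker.completeSpace_coe
  rw [positiveSubspace, Submodule.orthogonal_orthogonal] at hx
  have hx0 : a⁺ x = 0 := hx
  have negPart_nonneg : (a⁻).IsPositive :=
    (ContinuousLinearMap.nonneg_iff_isPositive _).1 (CFC.negPart_nonneg a)
  rw [← CFC.posPart_sub_negPart a ha, sub_apply, hx0, zero_sub, inner_neg_left, map_neg,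
    neg_nonpos]
  exact negPart_nonneg.2 x

theorem isSelfAdjoint_sq_sub_smul_one (hd : IsSelfAdjoint d) (c : ℝ) :
    IsSelfAdjoint (d ^ 2 - (c : ℂ) • 1) :=
  (hd.pow 2).sub (IsSelfAdjoint.smul (Complex.conj_ofReal c) (.one _))

theorem re_inner_sq_sub_smul_one_apply_self (hd : IsSelfAdjoint d) (c : ℝ) (x : H) :
    RCLike.re (inner ℂ ((d ^ 2 - (c : ℂ) • 1 : H →L[ℂ] H) x) x) = ‖d x‖ ^ 2 - c * ‖x‖ ^ 2 := by
  have inner_sq : inner ℂ (d (d x)) x = inner ℂ (d x) (d x) := by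
    rw [← d.adjoint_inner_right, hd.adjoint_eq]
  have apply_eq : (d ^ 2 - (c : ℂ) • 1 : H →L[ℂ] H) x = d (d x) - (c : ℂ) • x := by
    simp [pow_two]
  rw [apply_eq, inner_sub_left, inner_sq, inner_smul_left, map_sub, inner_self_eq_norm_sq,
    Complex.conj_ofReal, RCLike.re_eq_complex_re, Complex.re_ofReal_mul,
    ← RCLike.re_eq_complex_re, inner_self_eq_norm_sq]

end PositivePart

section GapSubspace

theorem commute_sub_sq_left {R : Type*} [Ring R] {p q : R} (hp : IsIdempotentElem p)
    (hq : IsIdempotentElem q) : Commute ((p - q) ^ 2) p := by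
  have hp' (x : R) : p * (p * x) = p * x := by rw [← mul_assoc, hp.eq]
  simp only [commute_iff_eq, sq, mul_sub, sub_mul, mul_assoc, hp.eq, hq.eq, hp']
  abel

variable {H : Type*} [NormedAddCommGroup H] [InnerProductSpace ℂ H] [CompleteSpace H]
  {S T : Submodule ℂ H} [S.HasOrthogonalProjection] [T.HasOrthogonalProjection] {c : ℝ}

/-- The spectral subspace of `|P - Q|` for `(c, ∞)`, where `P` and `Q` are the projections onto `S`
and `T`: it reduces both projections and collects the directions in which the gap between `S` and
`T` exceeds `c`. -/
noncomputable def gapSubspace (S T : Submodule ℂ H) [S.HasOrthogonalProjection]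
    [T.HasOrthogonalProjection] (c : ℝ) : Submodule ℂ H :=
  positiveSubspace ((S.starProjection - T.starProjection) ^ 2 - ((c ^ 2 : ℝ) : ℂ) • 1)

instance : CompleteSpace (gapSubspace S T c) :=
  inferInstanceAs (CompleteSpace (positiveSubspace _))

theorem gapSubspace_comm : gapSubspace T S c = gapSubspace S T c := by
  rw [gapSubspace, gapSubspace, ← neg_sub S.starProjection T.starProjection, neg_sq]

theorem commute_starProjection_gapSubspace_left :
    Commute (gapSubspace S T c).starProjection S.starProjection :=
  commute_starProjection_positiveSubspace (isSelfAdjoint_starProjection S)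
    ((commute_sub_sq_left S.isIdempotentElem_starProjection
      T.isIdempotentElem_starProjection).sub_left ((Commute.one_left _).smul_left _))

theorem commute_starProjection_gapSubspace_right :
    Commute (gapSubspace S T c).starProjection T.starProjection := by
  simpa only [gapSubspace_comm] using commute_starProjection_gapSubspace_left (S := T) (T := S)

theorem isSelfAdjoint_sub_starProjection :
    IsSelfAdjoint (S.starProjection - T.starProjection) :=
  (isSelfAdjoint_starProjection S).sub (isSelfAdjoint_starProjection T)

theorem mul_norm_le_of_mem_gapSubspace {x : H} (hx : x ∈ gapSubspace S T c) :
    c * ‖x‖ ≤ ‖S.starProjection x - T.starProjection x‖ := by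
  have h := re_inner_apply_self_nonneg_of_mem_positiveSubspace
    (isSelfAdjoint_sq_sub_smul_one isSelfAdjoint_sub_starProjection (c ^ 2)) hx
  rw [re_inner_sq_sub_smul_one_apply_self isSelfAdjoint_sub_starProjection, sub_nonneg,
    ← mul_pow] at h
  exact le_of_sq_le_sq h (norm_nonneg _)

theorem norm_sub_le_of_mem_orthogonal_gapSubspace (hc : 0 ≤ c) {x : H}
    (hx : x ∈ (gapSubspace S T c)ᗮ) :
    ‖S.starProjection x - T.starProjection x‖ ≤ c * ‖x‖ := by
  have h := re_inner_apply_self_nonpos_of_mem_orthogonal_positiveSubspace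
    (isSelfAdjoint_sq_sub_smul_one isSelfAdjoint_sub_starProjection (c ^ 2)) hx
  rw [re_inner_sq_sub_smul_one_apply_self isSelfAdjoint_sub_starProjection, sub_nonpos,
    ← mul_pow] at h
  exact le_of_sq_le_sq h (by positivity)

end GapSubspace

section CompressionReducing

variable {𝕜 H : Type*} [RCLike 𝕜] [NormedAddCommGroup H] [InnerProductSpace 𝕜 H]
  {L S T : Submodule 𝕜 H} {c : ℝ}

theorem norm_compression_orthogonal_apply [T.HasOrthogonalProjection] (s : S) :
    ‖compression S Tᗮ s‖ = ‖(s : H) - T.starProjection s‖ := by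
  rw [← Submodule.starProjection_orthogonal_val]
  rfl

variable [CompleteSpace H] [CompleteSpace L] [CompleteSpace T]

theorem norm_compression_inf_lt_one (hT : Commute L.starProjection T.starProjection) (hc : 0 < c)
    (h : ∀ s ∈ S ⊓ L, c * ‖s‖ ≤ ‖s - T.starProjection s‖) :
    ‖compression (S ⊓ L) (T ⊓ L)‖ < 1 := by
  refine (ContinuousLinearMap.opNorm_le_bound _ (Real.sqrt_nonneg (1 - c ^ 2)) fun s => ?_).trans_lt
    ((Real.sqrt_lt' one_pos).2 (by nlinarith))
  have pythagoras := T.norm_sq_eq_add_norm_sq_starProjection (s : H)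
  have gap := pow_le_pow_left₀ (by positivity) (h s s.2) 2
  rw [Submodule.starProjection_orthogonal_val] at pythagoras
  calc ‖compression (S ⊓ L) (T ⊓ L) s‖ = ‖T.starProjection s‖ :=
        congr_arg norm (starProjection_inf_apply hT s.2.2)
    _ ≤ √((1 - c ^ 2) * ‖(s : H)‖ ^ 2) := Real.le_sqrt_of_sq_le (by linarith)
    _ = √(1 - c ^ 2) * ‖s‖ := by
        rw [Real.sqrt_mul' _ (sq_nonneg _), Real.sqrt_sq (norm_nonneg _)]
        rfl

theorem norm_compression_inf_orthogonal_le (hT : Commute L.starProjection T.starProjection)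
    (hc : 0 ≤ c) (h : ∀ s ∈ S ⊓ L, ‖s - T.starProjection s‖ ≤ c * ‖s‖) :
    ‖compression (S ⊓ L) (T ⊓ L)ᗮ‖ ≤ c := by
  refine ContinuousLinearMap.opNorm_le_bound _ hc fun s => ?_
  rw [norm_compression_orthogonal_apply, starProjection_inf_apply hT s.2.2]
  exact h s s.2

end CompressionReducing

section GapReduction

variable {H : Type*} [NormedAddCommGroup H] [InnerProductSpace ℂ H] [CompleteSpace H]
  {S T : Submodule ℂ H} {c : ℝ}

theorem inf_orthogonal_le_gapSubspace [S.HasOrthogonalProjection] [T.HasOrthogonalProjection]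
    (hc₀ : 0 ≤ c) (hc₁ : c < 1) : S ⊓ Tᗮ ≤ gapSubspace S T c := by
  intro x ⟨hxS, hxT⟩
  have hS : Commute (gapSubspace S T c).starProjection S.starProjection :=
    commute_starProjection_gapSubspace_left
  have hT : Commute (gapSubspace S T c).starProjection T.starProjection :=
    commute_starProjection_gapSubspace_right
  have mem_S := starProjection_mem_of_commute (commute_starProjection_orthogonal hS) hxS
  have mem_T := starProjection_mem_of_commute
    (commute_starProjection_orthogonal (commute_starProjection_orthogonal hT.symm).symm) hxT
  have norm_le := norm_sub_le_of_mem_orthogonal_gapSubspace hc₀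
    ((gapSubspace S T c)ᗮ.starProjection_apply_mem x)
  rw [Submodule.starProjection_eq_self_iff.2 mem_S,
    (T.starProjection_apply_eq_zero_iff).2 mem_T, sub_zero] at norm_le
  rw [← Submodule.orthogonal_orthogonal (gapSubspace S T c),
    ← Submodule.starProjection_apply_eq_zero_iff]
  exact norm_le_zero_iff.1 (by nlinarith)

theorem inf_gapSubspace_inf_orthogonal [CompleteSpace S] [CompleteSpace T]
    (hc₀ : 0 ≤ c) (hc₁ : c < 1) :
    S ⊓ gapSubspace S T c ⊓ (T ⊓ gapSubspace S T c)ᗮ = S ⊓ Tᗮ := by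
  refine le_antisymm (fun x hx => ⟨hx.1.1, ?_⟩) fun x hx =>
    ⟨⟨hx.1, inf_orthogonal_le_gapSubspace hc₀ hc₁ hx⟩, Submodule.orthogonal_le inf_le_left hx.2⟩
  rw [inf_comm T] at hx
  exact mem_orthogonal_of_mem_inf_orthogonal commute_starProjection_gapSubspace_right.symm
    hx.1.2 hx.2

variable [CompleteSpace S] [CompleteSpace T]

theorem dim_inf_gapSubspace_add_dim (hc₀ : 0 ≤ c) (hc₁ : c < 1) :
    dim (S ⊓ gapSubspace S T c) + dim (T ⊓ Sᗮ) = dim (T ⊓ gapSubspace S T c) + dim (S ⊓ Tᗮ) := by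
  have hTS := inf_gapSubspace_inf_orthogonal (S := T) (T := S) hc₀ hc₁
  rw [gapSubspace_comm] at hTS
  rw [← inf_gapSubspace_inf_orthogonal (S := S) (T := T) hc₀ hc₁, ← hTS,
    dim_add_dim_inf_orthogonal]

theorem hasCommonComplement_of_dim_inf_gapSubspace_eq [TopologicalSpace.SeparableSpace H]
    (hc₀ : 0 < c) (hc₁ : c < 1)
    (h : dim (S ⊓ gapSubspace S T c) = dim (T ⊓ gapSubspace S T c)) :
    HasCommonComplement S T := by
  have hS : Commute (gapSubspace S T c).starProjection S.starProjection :=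
    commute_starProjection_gapSubspace_left
  have hT : Commute (gapSubspace S T c).starProjection T.starProjection :=
    commute_starProjection_gapSubspace_right
  obtain ⟨U⟩ := nonempty_linearIsometryEquiv_of_toENat_rank_eq h
  refine hasCommonComplement_of_commute hS hT
    (hasCommonComplement_of_norm_compression_lt_one U
      (norm_compression_inf_lt_one hT hc₀ fun s hs => ?_))
    (hasCommonComplement_of_norm_compression_orthogonal_lt_one
      ((norm_compression_inf_orthogonal_le (commute_starProjection_orthogonal hT) hc₀.le
        fun s hs => ?_).trans_lt hc₁)
      ((norm_compression_inf_orthogonal_le (commute_starProjection_orthogonal hS) hc₀.le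
        fun t ht => ?_).trans_lt hc₁))
  · simpa only [Submodule.starProjection_eq_self_iff.2 hs.1] using
      mul_norm_le_of_mem_gapSubspace hs.2
  · simpa only [Submodule.starProjection_eq_self_iff.2 hs.1] using
      norm_sub_le_of_mem_orthogonal_gapSubspace hc₀.le hs.2
  · simpa only [norm_sub_rev, Submodule.starProjection_eq_self_iff.2 ht.1] using
      norm_sub_le_of_mem_orthogonal_gapSubspace hc₀.le ht.2

variable [TopologicalSpace.SeparableSpace H]

theorem hasCommonComplement_of_dim_inf_orthogonal_eq (h : dim (S ⊓ Tᗮ) = dim (T ⊓ Sᗮ)) :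
    HasCommonComplement S T := by
  refine hasCommonComplement_of_dim_inf_gapSubspace_eq one_half_pos one_half_lt_one ?_
  have hST := dim_inf_gapSubspace_add_dim (S := S) (T := T) one_half_pos.le one_half_lt_one
  rw [← h] at hST
  by_cases htop : dim (S ⊓ Tᗮ) = ⊤
  · have le_S : S ⊓ Tᗮ ≤ S ⊓ gapSubspace S T (1 / 2) :=
      le_inf inf_le_left (inf_orthogonal_le_gapSubspace one_half_pos.le one_half_lt_one)
    have le_T : T ⊓ Sᗮ ≤ T ⊓ gapSubspace S T (1 / 2) := by
      rw [← gapSubspace_comm]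
      exact le_inf inf_le_left (inf_orthogonal_le_gapSubspace one_half_pos.le one_half_lt_one)
    have hS := dim_mono le_S
    have hT := dim_mono le_T
    rw [htop, top_le_iff] at hS
    rw [← h, htop, top_le_iff] at hT
    rw [hS, hT]
  · exact ENat.add_left_injective_of_ne_top htop hST

theorem dim_inf_gapSubspace_lt_top (hc₀ : 0 < c) (hc₁ : c < 1)
    (h : ¬ HasCommonComplement S T) (hfin : dim (S ⊓ Tᗮ) < ⊤) :
    dim (S ⊓ gapSubspace S T c) < ⊤ := by
  refine lt_top_iff_ne_top.2 fun hS => h ?_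
  have hST := dim_inf_gapSubspace_add_dim (S := S) (T := T) hc₀.le hc₁
  rw [hS, top_add, eq_comm, ENat.add_eq_top, or_iff_left hfin.ne] at hST
  exact hasCommonComplement_of_dim_inf_gapSubspace_eq hc₀ hc₁ (hS.trans hST.symm)

theorem isCompactOperator_compression_orthogonal (h : ¬ HasCommonComplement S T)
    (hfin : dim (S ⊓ Tᗮ) < ⊤) : IsCompactOperator (compression S Tᗮ) := by
  refine isCompactOperator_of_forall_exists_finiteDimensional fun ε hε => ?_
  obtain ⟨c, hc₀, hc⟩ := exists_between (lt_min hε one_pos)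
  have hfin := dim_lt_top_iff.1
    (dim_inf_gapSubspace_lt_top hc₀ (hc.trans_le (min_le_right _ _)) h hfin)
  refine ⟨(S ⊓ gapSubspace S T c).comap S.subtype,
    (Submodule.comapSubtypeEquivOfLe inf_le_left).symm.finiteDimensional, fun s hs => ?_⟩
  have hs' : (s : H) ∈ (S ⊓ gapSubspace S T c)ᗮ := fun x hx => hs ⟨x, hx.1⟩ hx
  have := norm_sub_le_of_mem_orthogonal_gapSubspace hc₀.le
    (mem_orthogonal_of_mem_inf_orthogonal commute_starProjection_gapSubspace_left s.2 hs')
  rw [Submodule.starProjection_eq_self_iff.2 s.2, ← norm_compression_orthogonal_apply] at this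
  refine this.trans ?_
  gcongr
  exacts [hc.le.trans (min_le_left _ _), le_rfl]

end GapReduction

section Characterization

variable {H : Type*} [NormedAddCommGroup H] [InnerProductSpace ℂ H] [CompleteSpace H]
  [TopologicalSpace.SeparableSpace H] {S T : Submodule ℂ H} [CompleteSpace S] [CompleteSpace T]

theorem not_hasCommonComplement_iff_hasBiorthogonalBases_left (hne : dim (S ⊓ Tᗮ) ≠ dim (T ⊓ Sᗮ))
    (hfin : dim (S ⊓ Tᗮ) < ⊤) : ¬ HasCommonComplement S T ↔ HasBiorthogonalBases S Tᗮ := by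
  rw [hasBiorthogonalBases_iff_isCompactOperator_compression]
  exact ⟨fun h => isCompactOperator_compression_orthogonal h hfin,
    fun hK h => hne (h.dim_inf_orthogonal_eq hK)⟩

theorem not_hasCommonComplement_iff_hasBiorthogonalBases_right (hne : dim (S ⊓ Tᗮ) ≠ dim (T ⊓ Sᗮ))
    (hfin : dim (T ⊓ Sᗮ) < ⊤) : ¬ HasCommonComplement S T ↔ HasBiorthogonalBases Sᗮ T := by
  rw [hasCommonComplement_comm, hasBiorthogonalBases_comm]
  exact not_hasCommonComplement_iff_hasBiorthogonalBases_left hne.symm hfin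

end Characterization

end CommonComplement

theorem mainTheorem11 {H : Type*} [NormedAddCommGroup H] [InnerProductSpace ℂ H]
    [CompleteSpace H] [TopologicalSpace.SeparableSpace H]
    (S T : Submodule ℂ H) (hS : IsClosed (S : Set H)) (hT : IsClosed (T : Set H)) :
    (¬ CommonComplement.HasCommonComplement S T ↔
      CommonComplement.dim (S ⊓ Tᗮ) ≠ CommonComplement.dim (Sᗮ ⊓ T) ∧
      (CommonComplement.dim (S ⊓ Tᗮ) < ⊤ → CommonComplement.HasBiorthogonalBases S Tᗮ) ∧
      (CommonComplement.dim (Sᗮ ⊓ T) < ⊤ → CommonComplement.HasBiorthogonalBases Sᗮ T)) ∧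
    (¬ CommonComplement.HasCommonComplement S T ↔
      CommonComplement.dim (S ⊓ Tᗮ) ≠ CommonComplement.dim (Sᗮ ⊓ T) ∧
      ((CommonComplement.dim (S ⊓ Tᗮ) < ⊤ ∧ CommonComplement.HasBiorthogonalBases S Tᗮ) ∨
       (CommonComplement.dim (Sᗮ ⊓ T) < ⊤ ∧ CommonComplement.HasBiorthogonalBases Sᗮ T))) := by
  have := hS.completeSpace_coe
  have := hT.completeSpace_coe
  rw [inf_comm Sᗮ]
  by_cases hdim : CommonComplement.dim (S ⊓ Tᗮ) = CommonComplement.dim (T ⊓ Sᗮ)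
  · simp only [CommonComplement.hasCommonComplement_of_dim_inf_orthogonal_eq hdim, hdim,
      not_true_eq_false, ne_eq, false_and, and_self]
  have finite_or_finite : CommonComplement.dim (S ⊓ Tᗮ) < ⊤ ∨ CommonComplement.dim (T ⊓ Sᗮ) < ⊤ :=
    (lt_or_gt_of_ne hdim).imp (·.trans_le le_top) (·.trans_le le_top)
  have iff_left := CommonComplement.not_hasCommonComplement_iff_hasBiorthogonalBases_left hdim
  have iff_right := CommonComplement.not_hasCommonComplement_iff_hasBiorthogonalBases_right hdim
  tauto
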